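/- Let $a\in\mathbb R$, let $\eta,\nu,\beta>0$, and let $h:\mathbb R\to\mathbb R$ be measurable and integrable on every bounded interval $[a,b]$ (for instance bounded). Put $$H(x)=\int_0^x\int_0^u h(v+a)\,dv\,du\quad(x\ge 0),\qquad \mu=\frac{\eta}{\nu},\qquad \sigma=\frac{2\beta}{\nu}.$$ Let $\mathcal P^+$ be the set of all Borel probability measures on $\mathbb R$ concentrated on $[0,\infty)$, and let $\mathcal P_2^+\subset\mathcal P^+$ be the set of those with at most two support points, i.e. of the form $\sum_{i=1}^l p_i\delta(x_i)$ with $1\le l\le 2$, $x_i\ge 0$, $p_i\ge 0$, $\sum_{i=1}^l p_i=1$. For a set $\mathcal D$ of probability measures on $[0,\infty)$ let $OPT(\mathcal D)$ be the program $$\max_{\mathbb P}\ \nu\,\mathbb E[H(X)]\quad\text{subject to}\quad \mathbb E[X]=\mu,\ \ \mathbb E[X^2]=\sigma,\ \ \mathbb P\in\mathcal D,$$ where $X$ has law $\mathbb P$; its optimal value is the supremum of the objective over the feasible $\mathbb P$, taken in $[-\infty,\infty]$ (and $-\infty$ if there is no feasible $\mathbb P$). Suppose that $H$ is convex on $[0,\infty)$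 and that, for some $0\le c\le\infty$, its derivative $H'$ is convex on $(0,c)$ and concave on $(c,\infty)$. Then $OPT(\mathcal P^+)$ and $OPT(\mathcal P_2^+)$ have the same optimal value. -/

import Mathlib

open MeasureTheory Set

noncomputable section

namespace TailMoment

/-- `H(x) = ∫₀ˣ ∫₀ᵘ h(v + a) dv du` (used for `x ≥ 0` only). -/
def H (h : ℝ → ℝ) (a : ℝ) (x : ℝ) : ℝ :=
  ∫ u in (0 : ℝ)..x, ∫ v in (0 : ℝ)..u, h (v + a)

/-- `μ = η / ν`. -/
def mu (η ν : ℝ) : ℝ := η / ν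

/-- `σ = 2 β / ν`. -/
def sigma (β ν : ℝ) : ℝ := 2 * β / ν

/-- The probability measures on `ℝ` that are concentrated on `M`. -/
def probOn (M : Set ℝ) : Set (Measure ℝ) :=
  {P | IsProbabilityMeasure P ∧ P Mᶜ = 0}

/-- The probability measures with at most `n` support points, all of them in `M`: the measures
`∑ pᵢ δ(xᵢ)` with `l` points `xᵢ ∈ M`, `1 ≤ l ≤ n`, and `p` in the probability simplex. -/
def finSuppOn (M : Set ℝ) (n : ℕ) : Set (Measure ℝ) :=
  {P | ∃ l : ℕ, 1 ≤ l ∧ l ≤ n ∧ ∃ (x : Fin l → ℝ) (p : Fin l → ℝ),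
    (∀ i, x i ∈ M) ∧ p ∈ stdSimplex ℝ (Fin l) ∧
    P = ∑ i, ENNReal.ofReal (p i) • Measure.dirac (x i)}

/-- The expectation of `g` under `P` with values in `[-∞, ∞]`: the expectation of the positive part
minus the expectation of the negative part. (It is meaningful unless both are infinite.) -/
def extExpectation (P : Measure ℝ) (g : ℝ → ℝ) : EReal :=
  ((∫⁻ x, ENNReal.ofReal (g x) ∂P : ENNReal) : EReal) -
    ((∫⁻ x, ENNReal.ofReal (-g x) ∂P : ENNReal) : EReal)

/-- The objective `Z(P) = ν E[H(X)]`. -/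
def objective (h : ℝ → ℝ) (a ν : ℝ) (P : Measure ℝ) : EReal :=
  (ν : EReal) * extExpectation P (H h a)

/-- The moment constraints `E[X] = m` and `E[X²] = s`, both expectations being finite. -/
def HasMoments (m s : ℝ) (P : Measure ℝ) : Prop :=
  Integrable (fun x : ℝ => x) P ∧ ∫ x, x ∂P = m ∧
    Integrable (fun x : ℝ => x ^ 2) P ∧ ∫ x, x ^ 2 ∂P = s

/-- The optimal value of the program: maximize `ν E[H(X)]` over `P ∈ D` subject to `E[X] = μ` and
`E[X²] = σ`. It is a supremum in `[-∞, ∞]`, equal to `-∞` for an infeasible program. -/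
def optValue (h : ℝ → ℝ) (a η ν β : ℝ) (D : Set (Measure ℝ)) : EReal :=
  sSup (objective h a ν '' {P | P ∈ D ∧ HasMoments (mu η ν) (sigma β ν) P})

/-- `H` is convex on `[0, ∞)`, and for some `0 ≤ c ≤ ∞` its derivative is convex on `(0, c)` and
concave on `(c, ∞)`. -/
def ConvexConcave (h : ℝ → ℝ) (a : ℝ) : Prop :=
  ConvexOn ℝ (Ici 0) (H h a) ∧
    ∃ c : EReal, 0 ≤ c ∧
      ConvexOn ℝ {x : ℝ | 0 < x ∧ (x : EReal) < c} (deriv (H h a)) ∧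
      ConcaveOn ℝ {x : ℝ | c < (x : EReal)} (deriv (H h a))

end TailMoment

end

/-! This is moment duality with quadratic certificates. Replace `H` by a C¹ extension `G` with
derivative `f`, and let m and s be the prescribed moments. A quadratic has the same mean under every
feasible law, so if it majorizes `G` on [0,∞) and meets `G` at both atoms of a feasible two-point
law, that law is optimal.

When m² < s, such laws are indexed by their lower atom y ∈ [0, m), the upper atom being `conj m s
y`. The sign of the trapezoidal error T(y) of `f` between the atoms decides the certificate. If T(0)
≤ 0, the quadratic through 0 that is tangent at the upper atom works. If T vanishes at some y, a
quadratic is tangent at both atoms. If T > 0 throughout, the quadratic tangent at y majorizes `G`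
only up to the upper atom; as y → m that atom escapes to infinity and the loss vanishes, so the
supremum is approached but perhaps not attained (`exists_pairMean_ge`).

The majorization counts sign changes of a strictly convex-then-concave derivative; a small bounded
perturbation supplies the strictness (`exists_pairMean_gt`). If `G` is not O(1 + x²), two-point laws
already give the value +∞. Zero variance leaves only a Dirac mass. -/

namespace TailMoment

/-! ### Sign patterns of convex-then-concave derivatives -/

/-- On every interval `[0, X]` the function is strictly convex up to some point and strictly concave
from there on, expressed by three-point inequalities. -/
def StrictConvexConcave (f : ℝ → ℝ) : Prop :=
  ∀ X : ℝ, ∃ c : ℝ,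
    (∀ x y z, 0 ≤ x → x < y → y < z → z ≤ c → f y * (z - x) < f x * (z - y) + f z * (y - x)) ∧
    (∀ x y z, 0 ≤ x → c ≤ x → x < y → y < z → z ≤ X →
      f x * (z - y) + f z * (y - x) < f y * (z - x))

theorem StrictConvexConcave.sub_affine {f : ℝ → ℝ} (hf : StrictConvexConcave f) (α β t : ℝ) :
    StrictConvexConcave (fun x => f x - (α + β * (x - t))) := by
  intro X
  obtain ⟨c, h1, h2⟩ := hf X
  refine ⟨c, fun x y z hx hxy hyz hz => ?_, fun x y z hx hc hxy hyz hz => ?_⟩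
  · have := h1 x y z hx hxy hyz hz
    linear_combination this
  · have := h2 x y z hx hc hxy hyz hz
    linear_combination this

theorem exists_deriv_pos_of_lt {D F : ℝ → ℝ} (hD : ∀ x, HasDerivAt D (F x) x) {a b : ℝ}
    (hab : a < b) (h : D a < D b) : ∃ u, a < u ∧ u < b ∧ 0 < F u := by
  obtain ⟨u, hu, he⟩ := exists_hasDerivAt_eq_slope D F hab
    (fun x _ => (hD x).continuousAt.continuousWithinAt) (fun x _ => hD x)
  exact ⟨u, hu.1, hu.2, by rw [he]; exact div_pos (by linarith) (by linarith)⟩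

theorem exists_deriv_neg_of_lt {D F : ℝ → ℝ} (hD : ∀ x, HasDerivAt D (F x) x) {a b : ℝ}
    (hab : a < b) (h : D b < D a) : ∃ u, a < u ∧ u < b ∧ F u < 0 := by
  obtain ⟨u, hu, he⟩ := exists_hasDerivAt_eq_slope D F hab
    (fun x _ => (hD x).continuousAt.continuousWithinAt) (fun x _ => hD x)
  exact ⟨u, hu.1, hu.2, by rw [he]; exact div_neg_of_neg_of_pos (by linarith) (by linarith)⟩

theorem exists_deriv_zero_of_eq {D F : ℝ → ℝ} (hD : ∀ x, HasDerivAt D (F x) x) {a b : ℝ}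
    (hab : a < b) (h : D a = D b) : ∃ u, a < u ∧ u < b ∧ F u = 0 := by
  obtain ⟨u, hu, he⟩ := exists_hasDerivAt_eq_zero hab
    (fun x _ => (hD x).continuousAt.continuousWithinAt) h (fun x _ => hD x)
  exact ⟨u, hu.1, hu.2, he⟩

/-- A function vanishing at `a` and `b` is nonpositive in between if its derivative is
convex-then-concave, nonpositive at `a` and nonnegative at `b`. -/
theorem nonpos_between {D F : ℝ → ℝ} (hD : ∀ x, HasDerivAt D (F x) x)
    (hF : StrictConvexConcave F) {a b y : ℝ} (ha : 0 ≤ a) (hDa : D a = 0) (hDb : D b = 0)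
    (hFa : F a ≤ 0) (hFb : 0 ≤ F b) (hay : a ≤ y) (hyb : y ≤ b) : D y ≤ 0 := by
  by_contra! hy
  have hay' : a < y := lt_of_le_of_ne hay (by rintro rfl; linarith)
  have hyb' : y < b := lt_of_le_of_ne hyb (by rintro rfl; linarith)
  obtain ⟨u, hau, huy, hu⟩ := exists_deriv_pos_of_lt hD hay' (by linarith)
  obtain ⟨v, hyv, hvb, hv⟩ := exists_deriv_neg_of_lt hD hyb' (by linarith)
  obtain ⟨c, h1, h2⟩ := hF b
  -- At a < u < v < b the signs of `F` are ≤0, +, −, ≥0. Convexity forbids the first three,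
  -- concavity the last three; if `c` separates u and v, then F(c) > 0 and c takes over the role of
  -- u.
  have huv : u < v := by linarith
  rcases le_or_gt v c with hc | hc
  · have := h1 a u v ha hau huv hc
    nlinarith [mul_pos hu (sub_pos.2 (hau.trans huv)),
      mul_nonneg (neg_nonneg.2 hFa) (sub_pos.2 huv).le, mul_pos (neg_pos.2 hv) (sub_pos.2 hau)]
  rcases le_or_gt c u with hc' | hc'
  · have := h2 u v b (by linarith) hc' huv hvb le_rfl
    nlinarith [mul_pos hu (sub_pos.2 hvb),
      mul_nonneg hFb (sub_pos.2 huv).le, mul_pos (neg_pos.2 hv) (sub_pos.2 (huv.trans hvb))]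
  have hFc : 0 < F c := by
    have := h1 a u c ha hau hc' le_rfl
    by_contra! hn
    nlinarith [mul_pos hu (sub_pos.2 (hau.trans hc')),
      mul_nonneg (neg_nonneg.2 hFa) (sub_pos.2 hc').le,
      mul_nonneg (neg_nonneg.2 hn) (sub_pos.2 hau).le]
  have := h2 c v b (by linarith) le_rfl hc hvb le_rfl
  nlinarith [mul_pos hFc (sub_pos.2 hvb),
      mul_nonneg hFb (sub_pos.2 hc).le, mul_pos (neg_pos.2 hv) (sub_pos.2 (hc.trans hvb))]

/-- A positive value left of a would make `F` negative at some u < a, and Rolle gives a zero ξ of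
`F` in (a, b). The pattern −, 0, 0, ≥0 at u < a < ξ < b contradicts strict convexity followed by
strict concavity. -/
theorem nonpos_left {D F : ℝ → ℝ} (hD : ∀ x, HasDerivAt D (F x) x)
    (hF : StrictConvexConcave F) {a b y : ℝ} (hab : a < b) (hDa : D a = 0) (hDb : D b = 0)
    (hFa : F a = 0) (hFb : 0 ≤ F b) (h0 : 0 ≤ y) (hya : y ≤ a) : D y ≤ 0 := by
  by_contra! hy
  have hya' : y < a := lt_of_le_of_ne hya (by rintro rfl; linarith)
  obtain ⟨u, hyu, hua, hu⟩ := exists_deriv_neg_of_lt hD hya' (by linarith)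
  obtain ⟨ξ, haξ, hξb, hξ⟩ := exists_deriv_zero_of_eq hD hab (by linarith)
  obtain ⟨c, h1, h2⟩ := hF b
  rcases le_or_gt c a with hc | hc
  · have := h2 a ξ b (by linarith) hc haξ hξb le_rfl
    nlinarith [mul_nonneg hFb (sub_pos.2 haξ).le]
  rcases le_or_gt ξ c with hc' | hc'
  · have := h1 u a ξ (by linarith) hua haξ hc'
    nlinarith [mul_pos (neg_pos.2 hu) (sub_pos.2 haξ)]
  have hFc : 0 < F c := by
    have := h1 u a c (by linarith) hua hc le_rfl
    by_contra! hn
    nlinarith [mul_pos (neg_pos.2 hu) (sub_pos.2 hc), mul_nonneg (neg_nonneg.2 hn) (sub_pos.2 hua).le]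
  have := h2 c ξ b (by linarith) le_rfl hc' hξb le_rfl
  nlinarith [mul_pos hFc (sub_pos.2 hξb), mul_nonneg hFb (sub_pos.2 hc').le]

/-- The mirror argument: the forbidden pattern is ≤0, 0, 0, + at a < ξ < b < v. -/
theorem nonpos_right {D F : ℝ → ℝ} (hD : ∀ x, HasDerivAt D (F x) x)
    (hF : StrictConvexConcave F) {a b y : ℝ} (ha : 0 ≤ a) (hab : a < b) (hDa : D a = 0)
    (hDb : D b = 0) (hFa : F a ≤ 0) (hFb : F b = 0) (hby : b ≤ y) : D y ≤ 0 := by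
  by_contra! hy
  have hby' : b < y := lt_of_le_of_ne hby (by rintro rfl; linarith)
  obtain ⟨v, hbv, hvy, hv⟩ := exists_deriv_pos_of_lt hD hby' (by linarith)
  obtain ⟨ξ, haξ, hξb, hξ⟩ := exists_deriv_zero_of_eq hD hab (by linarith)
  obtain ⟨c, h1, h2⟩ := hF y
  rcases le_or_gt b c with hc | hc
  · have := h1 a ξ b ha haξ hξb hc
    nlinarith [mul_nonneg (neg_nonneg.2 hFa) (sub_pos.2 hξb).le]
  rcases le_or_gt c ξ with hc' | hc'
  · have := h2 ξ b v (by linarith) hc' hξb hbv hvy.le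
    nlinarith [mul_pos hv (sub_pos.2 hξb)]
  have hFc : F c < 0 := by
    have := h2 c b v (by linarith) le_rfl hc hbv hvy.le
    by_contra! hn
    nlinarith [mul_pos hv (sub_pos.2 hc), mul_nonneg hn (sub_pos.2 hbv).le]
  have := h1 a ξ c ha haξ hc' le_rfl
  nlinarith [mul_pos (neg_pos.2 hFc) (sub_pos.2 haξ), mul_nonneg (neg_nonneg.2 hFa) (sub_pos.2 hc').le]

/-! ### Quadratic majorants from the trapezoidal error -/

/-- The quadratic polynomial that is tangent to `G` at `t` (where `G` has the derivative `f t`) and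
agrees with `G` at `p`. -/
noncomputable def hermite (G f : ℝ → ℝ) (t p x : ℝ) : ℝ :=
  G t + f t * (x - t) + (G p - G t - f t * (p - t)) / (p - t) ^ 2 * (x - t) ^ 2

/-- Twice the error of the trapezoidal rule for the mean of the derivative `f` of `G`. -/
noncomputable def trapezoid (G f : ℝ → ℝ) (a b : ℝ) : ℝ := f a + f b - 2 * ((G b - G a) / (b - a))

theorem hermite_left (G f : ℝ → ℝ) (t p : ℝ) : hermite G f t p t = G t := by simp [hermite]

theorem hermite_right (G f : ℝ → ℝ) {t p : ℝ} (h : p ≠ t) : hermite G f t p p = G p := by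
  have : p - t ≠ 0 := sub_ne_zero.2 h
  unfold hermite
  field_simp
  ring

theorem hasDerivAt_sub_hermite {G f : ℝ → ℝ} (hG : ∀ x, HasDerivAt G (f x) x) (t p x : ℝ) :
    HasDerivAt (fun x => G x - hermite G f t p x)
      (f x - (f t + 2 * ((G p - G t - f t * (p - t)) / (p - t) ^ 2) * (x - t))) x := by
  unfold hermite
  have h1 : HasDerivAt (fun x : ℝ => x - t) 1 x := (hasDerivAt_id x).sub_const t
  have h2 := ((h1.const_mul (f t)).const_add (G t)).add
    ((h1.pow 2).const_mul ((G p - G t - f t * (p - t)) / (p - t) ^ 2))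
  refine ((hG x).sub h2).congr_deriv ?_
  push_cast
  ring

theorem deriv_sub_hermite_right (G f : ℝ → ℝ) {t p : ℝ} (h : p ≠ t) :
    f p - (f t + 2 * ((G p - G t - f t * (p - t)) / (p - t) ^ 2) * (p - t)) =
      trapezoid G f t p := by
  have : p - t ≠ 0 := sub_ne_zero.2 h
  unfold trapezoid
  field_simp
  ring

theorem trapezoid_comm (G f : ℝ → ℝ) (a b : ℝ) : trapezoid G f a b = trapezoid G f b a := by
  unfold trapezoid
  rw [← neg_sub (G a), ← neg_sub a, neg_div_neg_eq]
  ring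

section Majorant

variable {G f : ℝ → ℝ} {a b x : ℝ}

/-- The trapezoidal error is the derivative at b of `G` minus the quadratic. If it is positive, `G`
crosses the quadratic upwards at b, hence the restriction x ≤ b. -/
theorem le_hermite_of_trapezoid_nonneg (hG : ∀ x, HasDerivAt G (f x) x)
    (hf : StrictConvexConcave f) (ha : 0 ≤ a) (hab : a < b) (h : 0 ≤ trapezoid G f a b)
    (hx : 0 ≤ x) (hxb : x ≤ b) : G x ≤ hermite G f a b x := by
  have hD := hasDerivAt_sub_hermite hG a b
  have hF := hf.sub_affine (f a) (2 * ((G b - G a - f a * (b - a)) / (b - a) ^ 2)) a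
  rw [← deriv_sub_hermite_right G f hab.ne'] at h
  refine sub_nonpos.1 ?_
  rcases le_total x a with hxa | hxa
  · exact nonpos_left hD hF hab (by simp [hermite_left]) (by simp [hermite_right G f hab.ne'])
      (by simp) h hx hxa
  · exact nonpos_between hD hF ha (by simp [hermite_left]) (by simp [hermite_right G f hab.ne'])
      (by simp) h hxa hxb

theorem le_hermite_of_trapezoid_eq_zero (hG : ∀ x, HasDerivAt G (f x) x)
    (hf : StrictConvexConcave f) (ha : 0 ≤ a) (hab : a < b) (h : trapezoid G f a b = 0)
    (hx : 0 ≤ x) : G x ≤ hermite G f a b x := by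
  rcases le_total x b with hxb | hxb
  · exact le_hermite_of_trapezoid_nonneg hG hf ha hab h.ge hx hxb
  have hD := hasDerivAt_sub_hermite hG a b
  have hF := hf.sub_affine (f a) (2 * ((G b - G a - f a * (b - a)) / (b - a) ^ 2)) a
  rw [← deriv_sub_hermite_right G f hab.ne'] at h
  exact sub_nonpos.1 (nonpos_right hD hF ha hab (by simp [hermite_left])
    (by simp [hermite_right G f hab.ne']) (by simp) h hxb)

/-- Since the half-line ends at 0, tangency is needed only at b; at 0 the sign of the slope
suffices. -/
theorem le_hermite_of_trapezoid_nonpos (hG : ∀ x, HasDerivAt G (f x) x)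
    (hf : StrictConvexConcave f) (hb : 0 < b) (h : trapezoid G f 0 b ≤ 0)
    (hx : 0 ≤ x) : G x ≤ hermite G f b 0 x := by
  have hD := hasDerivAt_sub_hermite hG b 0
  have hF := hf.sub_affine (f b) (2 * ((G 0 - G b - f b * (0 - b)) / (0 - b) ^ 2)) b
  rw [trapezoid_comm, ← deriv_sub_hermite_right G f hb.ne] at h
  refine sub_nonpos.1 ?_
  rcases le_total x b with hxb | hxb
  · exact nonpos_between hD hF le_rfl (by simp [hermite_right G f hb.ne]) (by simp [hermite_left])
      h (by simp) hx hxb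
  · exact nonpos_right hD hF le_rfl hb (by simp [hermite_right G f hb.ne]) (by simp [hermite_left])
      h (by simp) hxb

end Majorant

/-! ### Two-point laws with prescribed moments -/

open Filter Topology

/-- The second support point of the two-point law with mean `m`, second moment `s` and first
support point `y`. -/
noncomputable def conj (m s y : ℝ) : ℝ := m + (s - m ^ 2) / (m - y)

/-- The mean of `g` under the two-point law with mean `m`, second moment `s` and first
support point `y`. -/
noncomputable def pairMean (g : ℝ → ℝ) (m s y : ℝ) : ℝ :=
  (conj m s y - m) / (conj m s y - y) * g y + (m - y) / (conj m s y - y) * g (conj m s y)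

section Pair

variable {m s y : ℝ}

theorem lt_conj (hs : m ^ 2 < s) (hy : y < m) : m < conj m s y :=
  lt_add_of_pos_right _ (div_pos (sub_pos.2 hs) (sub_pos.2 hy))

theorem conj_mul (hy : y < m) : (conj m s y - m) * (m - y) = s - m ^ 2 := by
  have : m - y ≠ 0 := (sub_pos.2 hy).ne'
  unfold conj
  field_simp
  ring

theorem pairMean_congr {g k : ℝ → ℝ} (h1 : g y = k y) (h2 : g (conj m s y) = k (conj m s y)) :
    pairMean g m s y = pairMean k m s y := by
  unfold pairMean
  rw [h1, h2]

theorem pairMean_quadratic (hs : m ^ 2 < s) (hy : y < m) (A B C t : ℝ) :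
    pairMean (fun x => A + B * (x - t) + C * (x - t) ^ 2) m s y =
      A + B * (m - t) + C * (s - 2 * m * t + t ^ 2) := by
  have h1 := lt_conj hs hy
  have h2 := conj_mul (s := s) hy
  have h3 : conj m s y - y ≠ 0 := by linarith
  have h4 : s = (conj m s y - m) * (m - y) + m ^ 2 := by linarith
  unfold pairMean
  generalize conj m s y = b at *
  subst h4
  field_simp
  ring

theorem tendsto_conj (hs : m ^ 2 < s) : Tendsto (conj m s) (𝓝[<] m) atTop := by
  unfold conj
  refine tendsto_atTop_add_const_left _ _ ?_
  simp_rw [div_eq_mul_inv]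
  refine Tendsto.const_mul_atTop (sub_pos.2 hs) (tendsto_inv_nhdsGT_zero.comp ?_)
  refine tendsto_nhdsWithin_iff.2 ⟨?_, ?_⟩
  · have : Tendsto (fun y : ℝ => m - y) (𝓝 m) (𝓝 (m - m)) := by
      exact (continuous_const.sub continuous_id).tendsto m
    rw [sub_self] at this
    exact this.mono_left nhdsWithin_le_nhds
  · filter_upwards [self_mem_nhdsWithin] with y hy using sub_pos.2 (mem_Iio.1 hy)

theorem continuousOn_conj : ContinuousOn (conj m s) (Iio m) := by
  unfold conj
  exact continuousOn_const.add (continuousOn_const.div (by fun_prop)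
    fun x hx => (sub_pos.2 (mem_Iio.1 hx)).ne')

theorem continuousOn_trapezoid_conj {G f : ℝ → ℝ} (hG : Continuous G) (hf : Continuous f)
    (hs : m ^ 2 < s) :
    ContinuousOn (fun y => trapezoid G f y (conj m s y)) (Iio m) := by
  have hc := continuousOn_conj (m := m) (s := s)
  unfold trapezoid
  refine (hf.continuousOn.add (hf.comp_continuousOn hc)).sub
    (continuousOn_const.mul (((hG.comp_continuousOn hc).sub hG.continuousOn).div
      (hc.sub continuousOn_id) fun x hx => ?_))
  have := lt_conj hs hx
  simp only [mem_Iio] at hx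
  linarith

end Pair

/-! ### The duality bound for strictly convex-concave derivatives -/

section Moments

variable {m s : ℝ} {P : Measure ℝ} [IsProbabilityMeasure P]

theorem integrable_quadratic (hM : HasMoments m s P) (A B C t : ℝ) :
    Integrable (fun x => A + B * (x - t) + C * (x - t) ^ 2) P := by
  obtain ⟨h1, -, h2, -⟩ := hM
  have : (fun x : ℝ => A + B * (x - t) + C * (x - t) ^ 2) =
      fun x => (A - B * t + C * t ^ 2) + (B - 2 * C * t) * x + C * x ^ 2 := by
    ext x; ring
  rw [this]
  exact ((integrable_const _).add (h1.const_mul _)).add (h2.const_mul _)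

theorem integral_quadratic (hM : HasMoments m s P) (A B C t : ℝ) :
    ∫ x, (A + B * (x - t) + C * (x - t) ^ 2) ∂P =
      A + B * (m - t) + C * (s - 2 * m * t + t ^ 2) := by
  obtain ⟨h1, h1', h2, h2'⟩ := hM
  have : (fun x : ℝ => A + B * (x - t) + C * (x - t) ^ 2) =
      fun x => (A - B * t + C * t ^ 2) + (B - 2 * C * t) * x + C * x ^ 2 := by
    ext x; ring
  have i1 : Integrable (fun x => A - B * t + C * t ^ 2 + (B - 2 * C * t) * x) P :=
    (integrable_const _).add (h1.const_mul _)
  rw [this, integral_add i1 (h2.const_mul _),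
    integral_add (integrable_const _) (h1.const_mul _), integral_const_mul, integral_const_mul,
    h1', h2']
  simp
  ring

omit [IsProbabilityMeasure P] in
theorem ae_nonneg_of_compl_Ici (hP : P (Ici 0)ᶜ = 0) : ∀ᵐ x ∂P, (0 : ℝ) ≤ x := by
  rw [ae_iff]
  exact hP

theorem integrable_of_quadratic_growth {g : ℝ → ℝ} {K : ℝ} (hM : HasMoments m s P)
    (hP : P (Ici 0)ᶜ = 0) (hg : AEStronglyMeasurable g P)
    (hK : ∀ x, 0 ≤ x → |g x| ≤ K * (1 + x ^ 2)) : Integrable g P := by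
  refine Integrable.mono' (g := fun x => K * (1 + x ^ 2))
    (((integrable_const 1).add hM.2.2.1).const_mul K) hg ?_
  filter_upwards [ae_nonneg_of_compl_Ici hP] with x hx using hK x hx

/-- Weak duality: the mean of a quadratic depends only on m and s, so it may be computed under the
two-point law, where the quadratic agrees with `G`. -/
theorem integral_eq_pairMean {G Q : ℝ → ℝ} {y A B C t : ℝ} (hs : m ^ 2 < s) (hy : y < m)
    (hM : HasMoments m s P) (hQ : ∀ x, Q x = A + B * (x - t) + C * (x - t) ^ 2)
    (h1 : Q y = G y) (h2 : Q (conj m s y) = G (conj m s y)) :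
    Integrable Q P ∧ ∫ x, Q x ∂P = pairMean G m s y := by
  obtain rfl : Q = _ := funext hQ
  refine ⟨integrable_quadratic hM A B C t, ?_⟩
  rw [integral_quadratic hM, ← pairMean_quadratic hs hy, pairMean_congr h1 h2]

/-- Supplies the dominating function for the limit y → m, so `L` must not depend on y. -/
theorem exists_quadratic_bound_sub_hermite {G f : ℝ → ℝ} (hG : Continuous G) (hf : Continuous f)
    {K : ℝ} (hK : ∀ x, 0 ≤ x → |G x| ≤ K * (1 + x ^ 2)) (hm : 0 < m) (hs : m ^ 2 < s) :
    ∃ L, ∀ y, 0 ≤ y → y < m → ∀ x, 0 ≤ x →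
      |G x - hermite G f y (conj m s y) x| ≤ L * (1 + x ^ 2) := by
  have hK0 : 0 ≤ K := by
    have := (abs_nonneg _).trans (hK 0 le_rfl)
    simpa using this
  obtain ⟨M₁, hM₁⟩ := (isCompact_Icc (a := (0 : ℝ)) (b := m)).exists_bound_of_continuousOn
    hG.continuousOn
  obtain ⟨M₂, hM₂⟩ := (isCompact_Icc (a := (0 : ℝ)) (b := m)).exists_bound_of_continuousOn
    hf.continuousOn
  have hM₁0 : 0 ≤ M₁ := (norm_nonneg _).trans (hM₁ 0 ⟨le_rfl, hm.le⟩)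
  have hM₂0 : 0 ≤ M₂ := (norm_nonneg _).trans (hM₂ 0 ⟨le_rfl, hm.le⟩)
  -- A lower bound, uniform in y, for the distance between the atoms; it keeps the leading
  -- coefficient of the quadratic bounded by `C`.
  set d : ℝ := (s - m ^ 2) / m with hd
  have hd0 : 0 < d := div_pos (sub_pos.2 hs) hm
  set C : ℝ := K * (1 + 2 * m ^ 2) / d ^ 2 + 2 * K + M₁ / d ^ 2 + M₂ / d with hC
  have hC0 : 0 ≤ C := by positivity
  refine ⟨K + M₁ + M₂ * (1 + m) + C * (2 + 2 * m ^ 2), fun y hy0 hym x hx => ?_⟩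
  have hGy : |G y| ≤ M₁ := hM₁ y ⟨hy0, hym.le⟩
  have hfy : |f y| ≤ M₂ := hM₂ y ⟨hy0, hym.le⟩
  set r : ℝ := conj m s y - y with hr
  have hdr : d ≤ r := by
    have : d ≤ conj m s y - m := by
      simp only [conj, add_sub_cancel_left, hd]
      exact div_le_div_of_nonneg_left (sub_pos.2 hs).le (sub_pos.2 hym) (by linarith)
    linarith
  have hr0 : 0 < r := hd0.trans_le hdr
  have hGc : |G (conj m s y)| ≤ K * (1 + 2 * m ^ 2 + 2 * r ^ 2) := by
    refine (hK _ (by linarith)).trans (mul_le_mul_of_nonneg_left ?_ hK0)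
    have : conj m s y = y + r := by rw [hr]; ring
    rw [this]
    nlinarith [sq_nonneg (y - r), mul_nonneg hy0 (sub_pos.2 hym).le,
      mul_nonneg hm.le (sub_pos.2 hym).le]
  have hγ : |(G (conj m s y) - G y - f y * r) / r ^ 2| ≤ C := by
    rw [abs_div, abs_of_pos (pow_pos hr0 2), div_le_iff₀ (pow_pos hr0 2)]
    have e1 : |G (conj m s y) - G y - f y * r| ≤ K * (1 + 2 * m ^ 2 + 2 * r ^ 2) + M₁ + M₂ * r := by
      refine (abs_sub _ _).trans ?_
      rw [abs_mul, abs_of_pos hr0]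
      have := mul_le_mul_of_nonneg_right hfy hr0.le
      have := abs_sub (G (conj m s y)) (G y)
      linarith
    refine e1.trans ?_
    have i1 : 1 ≤ r ^ 2 / d ^ 2 := by
      rw [one_le_div (pow_pos hd0 2)]
      exact pow_le_pow_left₀ hd0.le hdr 2
    have i2 : r ≤ r ^ 2 / d := by
      rw [le_div_iff₀ hd0]
      nlinarith
    have : C * r ^ 2 = K * (1 + 2 * m ^ 2) * (r ^ 2 / d ^ 2) + 2 * K * r ^ 2 +
        M₁ * (r ^ 2 / d ^ 2) + M₂ * (r ^ 2 / d) := by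
      rw [hC]; ring
    rw [this]
    have := mul_le_mul_of_nonneg_left i1 (show 0 ≤ K * (1 + 2 * m ^ 2) by positivity)
    have := mul_le_mul_of_nonneg_left i1 hM₁0
    have := mul_le_mul_of_nonneg_left i2 hM₂0
    linarith
  have hxy : |x - y| ≤ x + m := abs_le.2 ⟨by linarith, by linarith⟩
  have hxy2 : (x - y) ^ 2 ≤ 2 * x ^ 2 + 2 * m ^ 2 := by
    nlinarith [sq_nonneg (x + y), mul_nonneg hy0 (sub_pos.2 hym).le,
      mul_nonneg hm.le (sub_pos.2 hym).le]
  have j1 : |f y * (x - y)| ≤ M₂ * (x + m) := by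
    rw [abs_mul]
    exact mul_le_mul hfy hxy (abs_nonneg _) hM₂0
  have j2 : |(G (conj m s y) - G y - f y * r) / r ^ 2 * (x - y) ^ 2| ≤
      C * (2 * x ^ 2 + 2 * m ^ 2) := by
    rw [abs_mul, abs_of_nonneg (sq_nonneg (x - y))]
    exact mul_le_mul hγ hxy2 (sq_nonneg _) hC0
  have j3 := hK x hx
  unfold hermite
  rw [← hr]
  have j4 := abs_sub (G x) (G y + f y * (x - y) +
    (G (conj m s y) - G y - f y * r) / r ^ 2 * (x - y) ^ 2)
  have j5 := abs_add_three (G y) (f y * (x - y))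
    ((G (conj m s y) - G y - f y * r) / r ^ 2 * (x - y) ^ 2)
  have k1 : x ≤ 1 + x ^ 2 := by nlinarith [sq_nonneg (x - 1)]
  have k2 := mul_le_mul_of_nonneg_left k1 hM₂0
  have k3 : 0 ≤ M₁ * x ^ 2 := by positivity
  have k4 : 0 ≤ M₂ * m * x ^ 2 := by positivity
  have k5 : 0 ≤ C * (2 + 2 * m ^ 2 * x ^ 2) := by positivity
  linarith

theorem exists_pairMean_ge {G f : ℝ → ℝ} (hG : ∀ x, HasDerivAt G (f x) x) (hfc : Continuous f)
    (hf : StrictConvexConcave f) {K : ℝ} (hK : ∀ x, 0 ≤ x → |G x| ≤ K * (1 + x ^ 2))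
    (hm : 0 < m) (hs : m ^ 2 < s) (hP : P (Ici 0)ᶜ = 0) (hM : HasMoments m s P)
    {δ : ℝ} (hδ : 0 < δ) :
    ∃ y, 0 ≤ y ∧ y < m ∧ ∫ x, G x ∂P ≤ pairMean G m s y + δ := by
  have hGc : Continuous G := continuous_iff_continuousAt.2 fun x => (hG x).continuousAt
  have hGi : Integrable G P :=
    integrable_of_quadratic_growth hM hP hGc.aestronglyMeasurable hK
  have hnn := ae_nonneg_of_compl_Ici hP
  rcases le_or_gt (trapezoid G f 0 (conj m s 0)) 0 with h0 | h0
  · refine ⟨0, le_rfl, hm, ?_⟩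
    have hb : 0 < conj m s 0 := hm.trans (lt_conj hs hm)
    obtain ⟨hQi, hQ⟩ := integral_eq_pairMean (P := P) (G := G) hs hm hM
      (Q := hermite G f (conj m s 0) 0) (fun x => rfl) (hermite_right G f hb.ne)
      (hermite_left G f _ _)
    have : ∫ x, G x ∂P ≤ ∫ x, hermite G f (conj m s 0) 0 x ∂P := by
      refine integral_mono_ae hGi hQi ?_
      filter_upwards [hnn] with x hx using le_hermite_of_trapezoid_nonpos hG hf hb h0 hx
    linarith
  by_cases hz : ∃ y, 0 ≤ y ∧ y < m ∧ trapezoid G f y (conj m s y) ≤ 0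
  · obtain ⟨y₁, hy₁0, hy₁m, hy₁⟩ := hz
    have hcont := (continuousOn_trapezoid_conj hGc hfc hs).mono
      (show Icc 0 y₁ ⊆ Iio m from fun x hx => lt_of_le_of_lt hx.2 hy₁m)
    obtain ⟨y, hy, hy0⟩ := intermediate_value_Icc' hy₁0 hcont ⟨hy₁, h0.le⟩
    have hym : y < m := lt_of_le_of_lt hy.2 hy₁m
    have hyc := hym.trans (lt_conj hs hym)
    refine ⟨y, hy.1, hym, ?_⟩
    obtain ⟨hQi, hQ⟩ := integral_eq_pairMean (P := P) (G := G) hs hym hM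
      (Q := hermite G f y (conj m s y)) (fun x => rfl) (hermite_left G f _ _)
      (hermite_right G f hyc.ne')
    have : ∫ x, G x ∂P ≤ ∫ x, hermite G f y (conj m s y) x ∂P := by
      refine integral_mono_ae hGi hQi ?_
      filter_upwards [hnn] with x hx using
        le_hermite_of_trapezoid_eq_zero hG hf hy.1 hyc hy0 hx
    linarith
  -- Now the error is positive for every y, and no single quadratic need majorize `G` on the whole
  -- half-line.
  push Not at hz
  obtain ⟨L, hL⟩ := exists_quadratic_bound_sub_hermite hGc hfc hK hm hs
  have hev : ∀ᶠ y in 𝓝[<] m, 0 ≤ y ∧ y < m := by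
    filter_upwards [Ioo_mem_nhdsLT hm] with y hy using ⟨hy.1.le, hy.2⟩
  have hhc : ∀ t p, Continuous fun x => max (G x - hermite G f t p x) 0 := by
    intro t p
    unfold hermite
    fun_prop
  have hlim : Tendsto (fun y => ∫ x, max (G x - hermite G f y (conj m s y) x) 0 ∂P)
      (𝓝[<] m) (𝓝 (∫ _, (0 : ℝ) ∂P)) := by
    refine tendsto_integral_filter_of_dominated_convergence (fun x => L * (1 + x ^ 2)) ?_ ?_ ?_ ?_
    · exact Eventually.of_forall fun y => (hhc _ _).aestronglyMeasurable
    · filter_upwards [hev] with y hy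
      filter_upwards [hnn] with x hx
      have := hL y hy.1 hy.2 x hx
      rw [Real.norm_of_nonneg (le_max_right _ _)]
      exact max_le ((le_abs_self _).trans this) ((abs_nonneg _).trans this)
    · exact ((integrable_const 1).add hM.2.2.1).const_mul L
    · filter_upwards [hnn] with x hx
      -- For fixed x the positive part is zero as soon as the upper atom has passed x.
      refine tendsto_const_nhds.congr' ?_
      filter_upwards [hev, (tendsto_conj hs).eventually_ge_atTop x] with y hy hxy
      refine (max_eq_right (sub_nonpos.2 ?_)).symm
      exact le_hermite_of_trapezoid_nonneg hG hf hy.1 (hy.2.trans (lt_conj hs hy.2))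
        (hz y hy.1 hy.2).le hx hxy
  rw [integral_zero] at hlim
  obtain ⟨y, hyδ, hy0, hym⟩ := ((hlim.eventually_lt_const hδ).and hev).exists
  refine ⟨y, hy0, hym, ?_⟩
  have hyc := hym.trans (lt_conj hs hym)
  obtain ⟨hQi, hQ⟩ := integral_eq_pairMean (P := P) (G := G) hs hym hM
    (Q := hermite G f y (conj m s y)) (fun x => rfl) (hermite_left G f _ _)
    (hermite_right G f hyc.ne')
  have hmax : Integrable (fun x => max (G x - hermite G f y (conj m s y) x) 0) P :=
    (hGi.sub hQi).pos_part
  have : ∫ x, G x ∂P ≤ ∫ x, (hermite G f y (conj m s y) x +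
      max (G x - hermite G f y (conj m s y) x) 0) ∂P := by
    refine integral_mono hGi (hQi.add hmax) fun x => ?_
    have := le_max_left (G x - hermite G f y (conj m s y) x) 0
    simp only
    linarith
  rw [integral_add hQi hmax, hQ] at this
  linarith

end Moments

/-! ### Perturbation to strict convexity and concavity -/

section Shape

theorem three_point_of_convexOn {g : ℝ → ℝ} {S : Set ℝ} (hg : ConvexOn ℝ S g) {x y z : ℝ}
    (hx : x ∈ S) (hz : z ∈ S) (hxy : x < y) (hyz : y < z) :
    g y * (z - x) ≤ g x * (z - y) + g z * (y - x) := by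
  have := hg.slope_mono_adjacent hx hz hxy hyz
  rw [div_le_div_iff₀ (sub_pos.2 hxy) (sub_pos.2 hyz)] at this
  linarith

theorem three_point_of_strictConvexOn {g : ℝ → ℝ} {S : Set ℝ} (hg : StrictConvexOn ℝ S g)
    {x y z : ℝ} (hx : x ∈ S) (hz : z ∈ S) (hxy : x < y) (hyz : y < z) :
    g y * (z - x) < g x * (z - y) + g z * (y - x) := by
  have := hg.slope_strict_mono_adjacent hx hz hxy hyz
  rw [div_lt_div_iff₀ (sub_pos.2 hxy) (sub_pos.2 hyz)] at this
  linarith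

/-- Carries the inequalities to the endpoints 0 and c, which the open intervals of the hypothesis
omit. -/
theorem three_point_of_forall_Ioo {f : ℝ → ℝ} (hf : Continuous f) {x y z : ℝ} (hxy : x < y)
    (hyz : y < z)
    (h : ∀ x' z', x < x' → x' < y → y < z' → z' < z →
      f y * (z' - x') ≤ f x' * (z' - y) + f z' * (y - x')) :
    f y * (z - x) ≤ f x * (z - y) + f z * (y - x) := by
  have h0 : (0 : ℝ) ∈ closure (Ioo 0 1) := by
    rw [closure_Ioo zero_ne_one]
    exact ⟨le_rfl, zero_le_one⟩
  have := ContinuousWithinAt.closure_le (s := Ioo (0 : ℝ) 1)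
    (f := fun t => f y * ((z - t * (z - y)) - (x + t * (y - x))))
    (g := fun t => f (x + t * (y - x)) * ((z - t * (z - y)) - y) +
      f (z - t * (z - y)) * (y - (x + t * (y - x)))) h0
    (Continuous.continuousWithinAt (by fun_prop)) (Continuous.continuousWithinAt (by fun_prop))
    (fun t ht => h _ _ (by nlinarith [mul_pos ht.1 (sub_pos.2 hxy)])
      (by nlinarith [mul_pos (sub_pos.2 ht.2) (sub_pos.2 hxy)])
      (by nlinarith [mul_pos (sub_pos.2 ht.2) (sub_pos.2 hyz)])
      (by nlinarith [mul_pos ht.1 (sub_pos.2 hyz)]))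
  simpa using this

theorem strictConvex_exp_neg {x y z : ℝ} (hxy : x < y) (hyz : y < z) :
    Real.exp (-y) * (z - x) < Real.exp (-x) * (z - y) + Real.exp (-z) * (y - x) := by
  have := three_point_of_strictConvexOn strictConvexOn_exp (mem_univ (-z)) (mem_univ (-x))
    (neg_lt_neg hyz) (neg_lt_neg hxy)
  linarith

theorem strictConvex_exp {x y z : ℝ} (hxy : x < y) (hyz : y < z) :
    Real.exp y * (z - x) < Real.exp x * (z - y) + Real.exp z * (y - x) :=
  three_point_of_strictConvexOn strictConvexOn_exp (mem_univ _) (mem_univ _) hxy hyz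

theorem exists_bounded_strict {c : EReal} (hc : 0 ≤ c) :
    ∃ ψ : ℝ → ℝ, Continuous ψ ∧ (∀ x, 0 ≤ x → |ψ x| ≤ 1) ∧
      ∀ f : ℝ → ℝ, (∀ x y z : ℝ, 0 ≤ x → x < y → y < z → (z : EReal) ≤ c →
          f y * (z - x) ≤ f x * (z - y) + f z * (y - x)) →
        (∀ x y z : ℝ, 0 ≤ x → c ≤ (x : EReal) → x < y → y < z →
          f x * (z - y) + f z * (y - x) ≤ f y * (z - x)) →
        ∀ ε : ℝ, 0 < ε → StrictConvexConcave (fun x => f x + ε * ψ x) := by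
  induction c with
  | bot => simp at hc
  | top =>
    -- With no finite turning point, `X` itself serves as one and the concave condition is vacuous.
    refine ⟨fun x => Real.exp (-x), by fun_prop, fun x hx => ?_, fun f h1 h2 ε hε X => ⟨X, ?_, ?_⟩⟩
    · rw [abs_of_pos (Real.exp_pos _)]
      exact Real.exp_le_one_iff.2 (by linarith)
    · intro x y z hx hxy hyz _
      have e1 := h1 x y z hx hxy hyz le_top
      have e2 := mul_lt_mul_of_pos_left (strictConvex_exp_neg hxy hyz) hε
      simp only
      linarith
    · intro x y z hx hX hxy hyz hz
      linarith
  | coe c =>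
    -- This is exp(x − c) − 1 left of c and 1 − exp(−(x − c)) right of it: bounded by 1, strictly
    -- convex, then strictly concave.
    refine ⟨fun x => Real.exp (min (x - c) 0) - Real.exp (-max (x - c) 0), by fun_prop,
      fun x hx => ?_, fun f h1 h2 ε hε X => ⟨c, ?_, ?_⟩⟩
    · have a1 : Real.exp (min (x - c) 0) ≤ 1 := Real.exp_le_one_iff.2 (min_le_right _ _)
      have a2 : Real.exp (-max (x - c) 0) ≤ 1 :=
        Real.exp_le_one_iff.2 (neg_nonpos.2 (le_max_right _ _))
      have a3 := Real.exp_pos (min (x - c) 0)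
      have a4 := Real.exp_pos (-max (x - c) 0)
      exact abs_le.2 ⟨by linarith, by linarith⟩
    · intro x y z hx hxy hyz hz
      have e1 := h1 x y z hx hxy hyz (by exact_mod_cast hz)
      have e2 := mul_lt_mul_of_pos_left
        (strictConvex_exp (sub_lt_sub_right hxy c) (sub_lt_sub_right hyz c)) hε
      beta_reduce
      rw [min_eq_left (by linarith), min_eq_left (by linarith), min_eq_left (by linarith),
        max_eq_right (by linarith), max_eq_right (by linarith), max_eq_right (by linarith)]
      simp only [neg_zero, Real.exp_zero]
      linarith
    · intro x y z hx hcx hxy hyz hz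
      have e1 := h2 x y z hx (by exact_mod_cast hcx) hxy hyz
      have e2 := mul_lt_mul_of_pos_left
        (strictConvex_exp_neg (sub_lt_sub_right hxy c) (sub_lt_sub_right hyz c)) hε
      beta_reduce
      rw [min_eq_right (by linarith), min_eq_right (by linarith), min_eq_right (by linarith),
        max_eq_left (by linarith), max_eq_left (by linarith), max_eq_left (by linarith)]
      simp only [Real.exp_zero]
      linarith

theorem exists_perturbation {f g : ℝ → ℝ} (hf : Continuous f) (hfg : ∀ x, 0 < x → g x = f x)
    {c : EReal} (hc : 0 ≤ c) (hconv : ConvexOn ℝ {x : ℝ | 0 < x ∧ (x : EReal) < c} g)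
    (hconc : ConcaveOn ℝ {x : ℝ | c < (x : EReal)} g) :
    ∃ ψ : ℝ → ℝ, Continuous ψ ∧ (∀ x, 0 ≤ x → |ψ x| ≤ 1) ∧
      ∀ ε : ℝ, 0 < ε → StrictConvexConcave (fun x => f x + ε * ψ x) := by
  obtain ⟨ψ, h1, h2, h3⟩ := exists_bounded_strict hc
  refine ⟨ψ, h1, h2, h3 f ?_ ?_⟩
  · intro x y z hx hxy hyz hz
    refine three_point_of_forall_Ioo hf hxy hyz fun x' z' h1 h2 h3 h4 => ?_
    have hz' : (z' : EReal) < c := lt_of_lt_of_le (EReal.coe_lt_coe_iff.2 h4) hz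
    have hx' : (x' : EReal) < c := lt_trans (EReal.coe_lt_coe_iff.2 (h2.trans h3)) hz'
    have := three_point_of_convexOn hconv (x := x') (y := y) (z := z') ⟨by linarith, hx'⟩
      ⟨by linarith, hz'⟩ h2 h3
    rwa [hfg _ (by linarith), hfg _ (by linarith), hfg _ (by linarith)] at this
  · intro x y z hx hcx hxy hyz
    have := three_point_of_forall_Ioo hf.neg hxy hyz fun x' z' h1 h2 h3 h4 => ?_
    · simp only [Pi.neg_apply] at this
      linarith
    have hx' : c < (x' : EReal) := lt_of_le_of_lt hcx (EReal.coe_lt_coe_iff.2 h1)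
    have hz' : c < (z' : EReal) := lt_trans hx' (EReal.coe_lt_coe_iff.2 (h2.trans h3))
    have := three_point_of_convexOn hconc.neg (x := x') (y := y) (z := z') hx' hz' h2 h3
    simp only [Pi.neg_apply] at this ⊢
    rwa [hfg _ (by linarith), hfg _ (by linarith), hfg _ (by linarith)] at this

end Shape

/-! ### Two-point laws beating a given value -/

section PairValues

variable {m s y : ℝ}

theorem pairMean_mono (hs : m ^ 2 < s) (hy : y < m) {g k : ℝ → ℝ} (h1 : g y ≤ k y)
    (h2 : g (conj m s y) ≤ k (conj m s y)) : pairMean g m s y ≤ pairMean k m s y := by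
  have h := lt_conj hs hy
  unfold pairMean
  refine add_le_add (mul_le_mul_of_nonneg_left h1 ?_) (mul_le_mul_of_nonneg_left h2 ?_) <;>
  exact div_nonneg (by linarith) (by linarith)

theorem pairMean_id (hs : m ^ 2 < s) (hy : y < m) : pairMean (fun x => x) m s y = m := by
  simpa using pairMean_quadratic hs hy 0 1 0 0

theorem pairMean_sq (hs : m ^ 2 < s) (hy : y < m) : pairMean (fun x => x ^ 2) m s y = s := by
  simpa using pairMean_quadratic hs hy 0 0 1 0

theorem pairMean_one (hs : m ^ 2 < s) (hy : y < m) : pairMean (fun _ => 1) m s y = 1 := by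
  simpa using pairMean_quadratic hs hy 1 0 0 0

/-- An upper atom at x carries mass at least (s − m²)/(1 + x²), so a value of `G` above K(1 + x²)
there contributes more than (s − m²)K. -/
theorem exists_pairMean_gt_of_unbounded {G : ℝ → ℝ} (hG : Continuous G)
    (hG0 : ∀ x, 0 ≤ x → 0 ≤ G x) (hK : ¬ ∃ K, ∀ x, 0 ≤ x → G x ≤ K * (1 + x ^ 2))
    (hm : 0 < m) (hs : m ^ 2 < s) (r : ℝ) : ∃ y, 0 ≤ y ∧ y < m ∧ r < pairMean G m s y := by
  obtain ⟨M, hM⟩ := (isCompact_Icc (a := (0 : ℝ)) (b := conj m s 0)).exists_bound_of_continuousOn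
    hG.continuousOn
  have hV : 0 < s - m ^ 2 := sub_pos.2 hs
  push Not at hK
  obtain ⟨x, hx0, hx⟩ := hK (|M| + |r| / (s - m ^ 2) + 1)
  -- The last two terms give (s − m²)K > r; the first forces x beyond `conj m s 0`, so that its
  -- partner atom is nonnegative.
  set K := |M| + |r| / (s - m ^ 2) + 1 with hKdef
  have hr : r < (s - m ^ 2) * K := by
    have : (s - m ^ 2) * K = (s - m ^ 2) * |M| + |r| + (s - m ^ 2) := by
      rw [hKdef]
      field_simp
    have := mul_nonneg hV.le (abs_nonneg M)
    have := le_abs_self r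
    linarith
  have hKM : |M| ≤ K := by
    have : 0 ≤ |r| / (s - m ^ 2) := by positivity
    linarith
  have hK0 : 0 ≤ K := (abs_nonneg M).trans hKM
  have hxb : conj m s 0 < x := by
    by_contra! hn
    have h1 := (le_abs_self _).trans ((hM x ⟨hx0, hn⟩).trans ((le_abs_self M).trans hKM))
    nlinarith [mul_nonneg hK0 (sq_nonneg x)]
  have hxm : m < x := (lt_conj hs hm).trans hxb
  have hy0 : 0 ≤ m - (s - m ^ 2) / (x - m) := by
    have : (s - m ^ 2) / m < x - m := by
      simp only [conj, sub_zero] at hxb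
      linarith
    rw [div_lt_iff₀ hm] at this
    rw [sub_nonneg, div_le_iff₀ (sub_pos.2 hxm)]
    linarith
  have hym : m - (s - m ^ 2) / (x - m) < m := sub_lt_self _ (div_pos hV (sub_pos.2 hxm))
  refine ⟨m - (s - m ^ 2) / (x - m), hy0, hym, ?_⟩
  have hc : conj m s (m - (s - m ^ 2) / (x - m)) = x := by
    have := (sub_pos.2 hxm).ne'
    unfold conj
    rw [sub_sub_cancel]
    field_simp
    ring
  have hcm := conj_mul (s := s) hym
  rw [hc] at hcm
  unfold pairMean
  rw [hc]
  set y := m - (s - m ^ 2) / (x - m)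
  have h1 : 0 ≤ (x - m) / (x - y) * G y :=
    mul_nonneg (div_nonneg (by linarith) (by linarith)) (hG0 y hy0)
  have h2 : (s - m ^ 2) / (1 + x ^ 2) ≤ (m - y) / (x - y) := by
    rw [div_le_div_iff₀ (by positivity) (by linarith), ← hcm]
    have : (x - m) * (x - y) ≤ 1 + x ^ 2 := by
      nlinarith [mul_nonneg hx0 hm.le, mul_nonneg hx0 hy0,
        mul_nonneg (sub_pos.2 hxm).le hy0]
    nlinarith [mul_le_mul_of_nonneg_left this (sub_pos.2 hym).le]
  have h3 : (s - m ^ 2) * K ≤ (m - y) / (x - y) * G x := by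
    calc (s - m ^ 2) * K = (s - m ^ 2) / (1 + x ^ 2) * (K * (1 + x ^ 2)) := by
          field_simp
      _ ≤ (m - y) / (x - y) * G x :=
          mul_le_mul h2 hx.le (by positivity) (div_nonneg (by linarith) (by linarith))
  linarith

theorem exists_pairMean_gt {G f ψ : ℝ → ℝ} {P : Measure ℝ} [IsProbabilityMeasure P]
    (hG : ∀ x, HasDerivAt G (f x) x) (hfc : Continuous f) (hψc : Continuous ψ)
    (hψ1 : ∀ x, 0 ≤ x → |ψ x| ≤ 1)
    (hψ : ∀ ε : ℝ, 0 < ε → StrictConvexConcave (fun x => f x + ε * ψ x))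
    {K : ℝ} (hK : ∀ x, 0 ≤ x → |G x| ≤ K * (1 + x ^ 2))
    (hm : 0 < m) (hs : m ^ 2 < s) (hP : P (Ici 0)ᶜ = 0) (hM : HasMoments m s P)
    {r : ℝ} (hr : r < ∫ x, G x ∂P) : ∃ y, 0 ≤ y ∧ y < m ∧ r < pairMean G m s y := by
  have hGc : Continuous G := continuous_iff_continuousAt.2 fun x => (hG x).continuousAt
  set Ψ : ℝ → ℝ := fun x => ∫ t in (0 : ℝ)..x, ψ t with hΨdef
  have hΨ : ∀ x, HasDerivAt Ψ (ψ x) x := fun x => hψc.integral_hasStrictDerivAt 0 x |>.hasDerivAt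
  have hΨc : Continuous Ψ := continuous_iff_continuousAt.2 fun x => (hΨ x).continuousAt
  have hΨx : ∀ x, 0 ≤ x → |Ψ x| ≤ x := by
    intro x hx
    have := intervalIntegral.norm_integral_le_of_norm_le_const (a := 0) (b := x) (f := ψ) (C := 1)
      (fun t ht => hψ1 t (by rw [uIoc_of_le hx] at ht; exact ht.1.le))
    simpa [abs_of_nonneg hx] using this
  have hq : ∀ x : ℝ, x ≤ 1 * (1 + x ^ 2) := fun x => by nlinarith [sq_nonneg (x - 1)]
  -- As |Ψ(x)| ≤ x, the perturbation moves either mean by at most εm, a quarter of the gap. With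
  -- another quarter for δ, three quarters are lost in all.
  set ε : ℝ := (∫ x, G x ∂P - r) / (4 * m) with hε
  have hε0 : 0 < ε := div_pos (sub_pos.2 hr) (by linarith)
  have hεm : ε * m = (∫ x, G x ∂P - r) / 4 := by
    rw [hε]
    field_simp
  have hKε : ∀ x, 0 ≤ x → |G x + ε * Ψ x| ≤ (K + ε) * (1 + x ^ 2) := by
    intro x hx
    have e1 := hK x hx
    have e2 := mul_le_mul_of_nonneg_left ((hΨx x hx).trans (hq x)) hε0.le
    have e3 := abs_add_le (G x) (ε * Ψ x)
    rw [abs_mul, abs_of_pos hε0] at e3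
    linarith
  obtain ⟨y, hy0, hym, hy⟩ := exists_pairMean_ge (P := P) (G := fun x => G x + ε * Ψ x)
    (f := fun x => f x + ε * ψ x) (fun x => (hG x).add ((hΨ x).const_mul ε)) (by fun_prop)
    (hψ ε hε0) hKε hm hs hP hM (half_pos (half_pos (sub_pos.2 hr)))
  refine ⟨y, hy0, hym, ?_⟩
  have hGi := integrable_of_quadratic_growth hM hP hGc.aestronglyMeasurable hK
  have hΨi := integrable_of_quadratic_growth hM hP hΨc.aestronglyMeasurable
    fun x hx => (hΨx x hx).trans (hq x)
  rw [integral_add hGi (hΨi.const_mul ε), integral_const_mul] at hy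
  have h1 : -m ≤ ∫ x, Ψ x ∂P := by
    have h := hM.2.1
    rw [← h, ← integral_neg]
    refine integral_mono_ae hM.1.neg hΨi ?_
    filter_upwards [ae_nonneg_of_compl_Ici hP] with x hx using (abs_le.1 (hΨx x hx)).1
  have h2 : pairMean (fun x => G x + ε * Ψ x) m s y = pairMean G m s y + ε * pairMean Ψ m s y := by
    unfold pairMean
    ring
  have h3 : pairMean Ψ m s y ≤ m := by
    refine (pairMean_mono hs hym ?_ ?_).trans_eq (pairMean_id hs hym)
    · exact (abs_le.1 (hΨx y hy0)).2
    · exact (abs_le.1 (hΨx _ ((hm.trans (lt_conj hs hym)).le))).2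
  rw [h2] at hy
  have h4 := mul_le_mul_of_nonneg_left h1 hε0.le
  have h5 := mul_le_mul_of_nonneg_left h3 hε0.le
  linarith

end PairValues

/-! ### Expectations and two-point measures -/

section Measures

theorem extExpectation_of_integrable {P : Measure ℝ} {g : ℝ → ℝ} (hg : Integrable g P) :
    extExpectation P g = ((∫ x, g x ∂P : ℝ) : EReal) := by
  have h1 : ∫⁻ x, ENNReal.ofReal (g x) ∂P ≠ ⊤ := hg.lintegral_lt_top.ne
  have h2 : ∫⁻ x, ENNReal.ofReal (-g x) ∂P ≠ ⊤ := hg.neg.lintegral_lt_top.ne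
  rw [integral_eq_lintegral_pos_part_sub_lintegral_neg_part hg, EReal.coe_sub,
    EReal.coe_ennreal_toReal h1, EReal.coe_ennreal_toReal h2]
  rfl

theorem objective_of_integrable {P : Measure ℝ} {h G : ℝ → ℝ} {a ν : ℝ} (hP : P (Ici 0)ᶜ = 0)
    (hG : ∀ x, 0 ≤ x → G x = H h a x) (hGi : Integrable G P) :
    objective h a ν P = ((ν * ∫ x, G x ∂P : ℝ) : EReal) := by
  have hae : G =ᵐ[P] H h a := by
    filter_upwards [ae_nonneg_of_compl_Ici hP] with x hx using hG x hx
  rw [objective, extExpectation_of_integrable (hGi.congr hae), integral_congr_ae hae,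
    EReal.coe_mul]

theorem finSuppOn_subset_probOn {M : Set ℝ} (hM : MeasurableSet M) (n : ℕ) :
    finSuppOn M n ⊆ probOn M := by
  rintro P ⟨l, -, -, x, p, hx, hp, rfl⟩
  refine ⟨⟨?_⟩, ?_⟩
  · simp only [Measure.coe_finsetSum, Finset.sum_apply, Measure.smul_apply, smul_eq_mul,
      measure_univ, mul_one]
    rw [← ENNReal.ofReal_sum_of_nonneg fun i _ => hp.1 i, hp.2, ENNReal.ofReal_one]
  · simp [Measure.dirac_apply' _ hM.compl, hx]

/-- The law `p δ_x + q δ_y`. -/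
noncomputable def twoPoint (x y p q : ℝ) : Measure ℝ :=
  ENNReal.ofReal p • Measure.dirac x + ENNReal.ofReal q • Measure.dirac y

theorem twoPoint_mem_finSuppOn {M : Set ℝ} {x y p q : ℝ} (hx : x ∈ M) (hy : y ∈ M) (hp : 0 ≤ p)
    (hq : 0 ≤ q) (hpq : p + q = 1) : twoPoint x y p q ∈ finSuppOn M 2 := by
  refine ⟨2, by norm_num, le_rfl, ![x, y], ![p, q], ?_, ⟨?_, ?_⟩, ?_⟩
  · intro i; fin_cases i <;> assumption
  · intro i; fin_cases i <;> assumption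
  · simpa using hpq
  · simp [twoPoint]

theorem integrable_twoPoint (g : ℝ → ℝ) (x y p q : ℝ) : Integrable g (twoPoint x y p q) :=
  ((integrable_dirac (by simp)).smul_measure ENNReal.ofReal_ne_top).add_measure
    ((integrable_dirac (by simp)).smul_measure ENNReal.ofReal_ne_top)

theorem integral_twoPoint (g : ℝ → ℝ) {x y p q : ℝ} (hp : 0 ≤ p) (hq : 0 ≤ q) :
    ∫ t, g t ∂(twoPoint x y p q) = p * g x + q * g y := by
  rw [twoPoint, integral_add_measure
    ((integrable_dirac (by simp)).smul_measure ENNReal.ofReal_ne_top)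
    ((integrable_dirac (by simp)).smul_measure ENNReal.ofReal_ne_top), integral_smul_measure,
    integral_smul_measure, integral_dirac, integral_dirac, ENNReal.toReal_ofReal hp,
    ENNReal.toReal_ofReal hq, smul_eq_mul, smul_eq_mul]

theorem exists_finSuppOn_objective_eq {m s y : ℝ} {h G : ℝ → ℝ} {a : ℝ} (ν : ℝ)
    (hG : ∀ x, 0 ≤ x → G x = H h a x) (hm : 0 < m) (hs : m ^ 2 < s) (hy0 : 0 ≤ y) (hym : y < m) :
    ∃ Q, (Q ∈ finSuppOn (Ici 0) 2 ∧ HasMoments m s Q) ∧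
      objective h a ν Q = ((ν * pairMean G m s y : ℝ) : EReal) := by
  have hc := lt_conj hs hym
  have hp : 0 ≤ (conj m s y - m) / (conj m s y - y) := div_nonneg (by linarith) (by linarith)
  have hq : 0 ≤ (m - y) / (conj m s y - y) := div_nonneg (by linarith) (by linarith)
  have hmean : ∀ g : ℝ → ℝ, ∫ t, g t ∂(twoPoint y (conj m s y)
      ((conj m s y - m) / (conj m s y - y)) ((m - y) / (conj m s y - y))) = pairMean g m s y :=
    fun g => integral_twoPoint g hp hq
  have hmem := twoPoint_mem_finSuppOn (M := Ici 0) (mem_Ici.2 hy0)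
    (mem_Ici.2 (hm.trans hc).le) hp hq (by simpa [pairMean] using pairMean_one hs hym)
  refine ⟨_, ⟨hmem, integrable_twoPoint _ _ _ _ _, (hmean _).trans (pairMean_id hs hym),
    integrable_twoPoint _ _ _ _ _, (hmean _).trans (pairMean_sq hs hym)⟩, ?_⟩
  rw [objective_of_integrable (finSuppOn_subset_probOn measurableSet_Ici 2 hmem).2 hG
    (integrable_twoPoint _ _ _ _ _), hmean]

theorem sq_le_of_hasMoments {m s : ℝ} {P : Measure ℝ} [IsProbabilityMeasure P]
    (hM : HasMoments m s P) : m ^ 2 ≤ s := by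
  have h := integral_quadratic hM 0 0 1 m
  have : 0 ≤ ∫ x, (0 + 0 * (x - m) + 1 * (x - m) ^ 2) ∂P :=
    integral_nonneg fun x => by simpa using sq_nonneg (x - m)
  linarith

theorem eq_dirac_of_hasMoments {m : ℝ} {P : Measure ℝ} [IsProbabilityMeasure P]
    (hM : HasMoments m (m ^ 2) P) : P = Measure.dirac m := by
  have h := integral_quadratic hM 0 0 1 m
  rw [show (0 : ℝ) + 0 * (m - m) + 1 * (m ^ 2 - 2 * m * m + m ^ 2) = 0 by ring,
    integral_eq_zero_iff_of_nonneg (fun x => by simpa using sq_nonneg (x - m))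
      (integrable_quadratic hM 0 0 1 m)] at h
  have hae : (id : ℝ → ℝ) =ᵐ[P] fun _ => m := by
    filter_upwards [h] with x hx
    simpa [sub_eq_zero] using hx
  calc P = P.map id := Measure.map_id.symm
    _ = P.map fun _ => m := Measure.map_congr hae
    _ = Measure.dirac m := by rw [Measure.map_const]; simp

end Measures

/-- `H` agrees on `[0, ∞)` with a continuously differentiable function on `ℝ`. -/
theorem exists_extension {h : ℝ → ℝ} {a : ℝ}
    (h_int : ∀ b, a ≤ b → IntegrableOn h (Icc a b) volume) :
    ∃ f G : ℝ → ℝ, Continuous f ∧ (∀ x, HasDerivAt G (f x) x) ∧ f 0 = 0 ∧ G 0 = 0 ∧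
      ∀ x, 0 ≤ x → G x = H h a x := by
  -- Integrability of `h` is assumed only to the right of `a`, so the integrand is cut off at 0.
  set k : ℝ → ℝ := (Ici 0).indicator fun v => h (v + a) with hk
  have hI : ∀ M : ℝ, 0 ≤ M → IntegrableOn (fun v => h (v + a)) (Icc 0 M) := by
    intro M hM
    have h1 : IntervalIntegrable h volume a (M + a) :=
      (intervalIntegrable_iff_integrableOn_Icc_of_le (by linarith)).2 (h_int _ (by linarith))
    have h2 := h1.comp_add_right a
    rw [sub_self, add_sub_cancel_right] at h2
    exact (intervalIntegrable_iff_integrableOn_Icc_of_le hM).1 h2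
  have hki : ∀ x y, IntervalIntegrable k volume x y := by
    intro x y
    rw [intervalIntegrable_iff, hk, integrableOn_indicator_iff measurableSet_Ici]
    refine (hI (max (max x y) 0) (le_max_right _ _)).mono_set ?_
    rintro v ⟨hv0, hv⟩
    exact ⟨hv0, hv.2.trans (le_max_left _ _)⟩
  have hfc : Continuous fun x => ∫ v in (0 : ℝ)..x, k v :=
    intervalIntegral.continuous_primitive hki 0
  refine ⟨fun x => ∫ v in (0 : ℝ)..x, k v, fun x => ∫ u in (0 : ℝ)..x, ∫ v in (0 : ℝ)..u, k v,
    hfc, fun x => (hfc.integral_hasStrictDerivAt 0 x).hasDerivAt, by simp, by simp, ?_⟩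
  intro x hx
  refine intervalIntegral.integral_congr fun u hu => ?_
  rw [uIcc_of_le hx] at hu
  refine intervalIntegral.integral_congr fun v hv => ?_
  rw [uIcc_of_le hu.1] at hv
  exact indicator_of_mem hv.1 _

end TailMoment

theorem proposition2 (h : ℝ → ℝ) (a η ν β : ℝ) (hη : 0 < η) (hν : 0 < ν) (hβ : 0 < β)
    (h_meas : Measurable h) (h_int : ∀ b, a ≤ b → IntegrableOn h (Icc a b) volume)
    (hH : TailMoment.ConvexConcave h a) :
    TailMoment.optValue h a η ν β (TailMoment.probOn (Ici 0)) =
      TailMoment.optValue h a η ν β (TailMoment.finSuppOn (Ici 0) 2) := by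
  open TailMoment in
  refine le_antisymm (sSup_le ?_) (sSup_le_sSup (image_mono fun P hP =>
    ⟨finSuppOn_subset_probOn measurableSet_Ici 2 hP.1, hP.2⟩))
  rintro _ ⟨P, ⟨⟨hPp, hP0⟩, hM⟩, rfl⟩
  obtain ⟨hconvH, c, hc, hconv, hconc⟩ := hH
  obtain ⟨f, G, hfc, hG, hf0, hG0, hGH⟩ := exists_extension h_int
  have hGc : Continuous G := continuous_iff_continuousAt.2 fun x => (hG x).continuousAt
  have hm : 0 < mu η ν := div_pos hη hν
  set m := mu η ν
  set s := sigma β ν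
  -- With zero variance `P` is the Dirac mass at m, itself finitely supported.
  rcases (sq_le_of_hasMoments hM).eq_or_lt with hs | hs
  · have hM' := hM
    rw [← hs] at hM'
    refine le_sSup ⟨P, ⟨⟨1, le_rfl, by norm_num, fun _ => m, fun _ => 1, fun _ => hm.le,
      ⟨fun _ => zero_le_one, by simp⟩, ?_⟩, hM⟩, rfl⟩
    simpa using eq_dirac_of_hasMoments hM'
  have hpair : ∀ y, 0 ≤ y → y < m → ((ν * pairMean G m s y : ℝ) : EReal) ≤
      optValue h a η ν β (finSuppOn (Ici 0) 2) := by
    intro y hy0 hym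
    obtain ⟨Q, hQ, hQo⟩ := exists_finSuppOn_objective_eq ν hGH hm hs hy0 hym
    exact le_sSup ⟨Q, hQ, hQo⟩
  -- Convexity together with G(0) = G'(0) = 0 puts `G` above its tangent at 0. An upper growth bound
  -- then controls |G|, and failure of one drives the value to +∞.
  have hGnn : ∀ x, 0 ≤ x → 0 ≤ G x := by
    intro x hx
    rcases hx.eq_or_lt with rfl | hx'
    · exact hG0.ge
    have hcG : ConvexOn ℝ (Ici 0) G := hconvH.congr fun x hx => (hGH x hx).symm
    have := hcG.le_slope_of_hasDerivAt (mem_Ici.2 le_rfl) hx hx' (hG 0)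
    rw [hf0, slope_def_field, hG0, sub_zero, sub_zero, le_div_iff₀ hx', zero_mul] at this
    exact this
  by_cases hK : ∃ K, ∀ x, 0 ≤ x → G x ≤ K * (1 + x ^ 2)
  · obtain ⟨K, hK⟩ := hK
    have hK' : ∀ x, 0 ≤ x → |G x| ≤ K * (1 + x ^ 2) := fun x hx => by
      rw [abs_of_nonneg (hGnn x hx)]
      exact hK x hx
    have hd : ∀ x, 0 < x → deriv (H h a) x = f x := by
      intro x hx
      have : H h a =ᶠ[nhds x] G := by
        filter_upwards [Ioi_mem_nhds hx] with t ht using (hGH t (le_of_lt ht)).symm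
      rw [this.deriv_eq, (hG x).deriv]
    obtain ⟨ψ, hψc, hψ1, hψ⟩ := exists_perturbation hfc hd hc hconv hconc
    rw [objective_of_integrable hP0 hGH
      (integrable_of_quadratic_growth hM hP0 hGc.aestronglyMeasurable hK')]
    by_contra! hlt
    obtain ⟨r, hr1, hr2⟩ := EReal.lt_iff_exists_real_btwn.1 hlt
    have hr : r / ν < ∫ x, G x ∂P := by
      rw [div_lt_iff₀ hν, mul_comm]
      exact_mod_cast hr2
    obtain ⟨y, hy0, hym, hy⟩ := exists_pairMean_gt hG hfc hψc hψ1 hψ hK' hm hs hP0 hM hr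
    rw [div_lt_iff₀ hν, mul_comm] at hy
    exact absurd (hpair y hy0 hym) (not_le.2 (hr1.trans (EReal.coe_lt_coe_iff.2 hy)))
  · refine le_top.trans_eq (Eq.symm (EReal.eq_top_iff_forall_lt _ |>.2 fun r => ?_))
    obtain ⟨y, hy0, hym, hy⟩ := exists_pairMean_gt_of_unbounded hGc hGnn hK hm hs (r / ν)
    rw [div_lt_iff₀ hν, mul_comm] at hy
    exact (EReal.coe_lt_coe_iff.2 hy).trans_le (hpair y hy0 hym)
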